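/- **Setting.** Let $d\in\{2,3\}$ and let $\Omega\subset\mathbb{R}^d$ be a bounded open set whose closure is the union of the cells of a finite conforming triangulation $\mathcal{T}_h$, each cell being a nondegenerate simplex or an affine image of the unit cube (for instance, $\Omega$ is a polyhedral Lipschitz domain). Write $(\cdot,\cdot)$ and $\|\cdot\|$ for the inner product and norm of $\mathbf{L}^2=[L^2(\Omega)]^d$ and of $[L^2(\Omega)]^{d\times d}$. Let $\mathbf{X}=[H^1_0(\Omega)]^d$, and for $f$ in its dual $\mathbf{H}^{-1}$ let $\|f\|_{\mathbf{H}^{-1}}=\sup\{|\langle f,v\rangle| : v\in\mathbf{X},\ \|\nabla v\|\le 1\}$. Put $$b(u,v,w)=\tfrac12\big[(u\cdot\nabla v,w)-(u\cdot\nabla w,v)\big],\qquad (g,h)_\tau=\sum_{K\in\mathcal{T}_h}\tau_K\int_K g\cdot h\,dx,\qquad \|g\|_\tau=(g,g)_\tau^{1/2},$$ with stabilization parameters $\tau_K>0$. Let $\nu>0$, $T>0$, $N\ge 1$, $\Delta t=T/N$, $t_n=n\Delta t$, let $f^{n}=f(t_n)\in\mathbf{H}^{-1}$ and $u^0\in\mathbf{X}$.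 **POD modes.** For snapshots $y_1,\dots,y_S$ in a space with inner product $(\cdot,\cdot)_{\mathcal H}$, let $z_1,\dots,z_S$ be orthonormal eigenvectors of the correlation matrix $K_{mn}=\frac1S(y_n,y_m)_{\mathcal H}$ for the eigenvalues $\lambda_1\ge\dots\ge\lambda_S$. For $r$ with $\lambda_r>0$ (or $r=0$), the first $r$ POD modes are $\varphi_i=(S\lambda_i)^{-1/2}\sum_{n}(z_i)_n\,y_n$, $1\le i\le r$; they are orthonormal in $\mathcal H$. Let $\varphi_1,\dots,\varphi_r$ be the first $r$ POD modes, for the inner product $(\nabla\cdot,\nabla\cdot)$, of velocity snapshots $y_1,\dots,y_S\in\mathbf{X}$ with $y_i\cdot\nabla y_j\in\mathbf{L}^2$ for all $i,j$ (as is the case for finite element functions), and put $\mathbf{X}^r=\mathrm{span}\{\varphi_1,\dots,\varphi_r\}$. Let $\widehat\varphi_1,\dots,\widehat\varphi_R$, $R\le r$, be the first $R$ POD modes, for the $\mathbf{L}^2$ inner product, of the convective derivatives $u_h^{n}\cdot\nabla u_h^{n}\in\mathbf{L}^2$, $n=1,\dots,N$, of given velocities $u_h^n\in\mathbf{X}$.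 Let $P_R$ be the $\mathbf{L}^2$-orthogonal projection onto $\mathrm{span}\{\widehat\varphi_1,\dots,\widehat\varphi_R\}$ and $P'_R=I-P_R$. **The fully implicit SD-POD-ROM.** Set $u_r^0=\sum_{i=1}^r(\nabla u^0,\nabla\varphi_i)\varphi_i$, and for $n=0,\dots,N-1$ find $u_r^{n+1}\in\mathbf{X}^r$ such that for all $\varphi\in\mathbf{X}^r$ $$\Big(\frac{u_r^{n+1}-u_r^n}{\Delta t},\varphi\Big)+b(u_r^{n+1},u_r^{n+1},\varphi)+\nu(\nabla u_r^{n+1},\nabla\varphi)+\big(P'_R(u_r^{n+1}\cdot\nabla u_r^{n+1}),P'_R(u_r^{n+1}\cdot\nabla\varphi)\big)_\tau=\langle f^{n+1},\varphi\rangle .$$ **Lemma (existence and stability).** For each $n\in\{0,\dots,N-1\}$ and each $u_r^n\in\mathbf{X}^r$ the equation of the $n$-th step has a solution $u_r^{n+1}\in\mathbf{X}^r$; in particular the SD-POD-ROM has a solution $(u_r^n)_{0\le n\le N}$. Every solution satisfies, for $k=0,\dots,N$, $$\|u_r^k\|^2+\Delta t\sum_{n=0}^{k-1}\Big(\nu\|\nabla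 u_r^{n+1}\|^2+\|P'_R(u_r^{n+1}\cdot\nabla u_r^{n+1})\|_\tau^2\Big)\le\|u_r^0\|^2+\frac{\Delta t}{\nu}\sum_{n=0}^{k-1}\|f^{n+1}\|_{\mathbf{H}^{-1}}^2 .$$ -/

import Mathlib

open MeasureTheory
open scoped ContDiff

namespace SDPODROM

noncomputable section

/-- The space `ℝ^d` with its Euclidean norm. -/
abbrev Vec (d : ℕ) : Type := EuclideanSpace ℝ (Fin d)

/-- Real `d × d` matrices with the Frobenius inner product. -/
abbrev Mat (d : ℕ) : Type := EuclideanSpace ℝ (Fin d × Fin d)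

/-- The Lebesgue measure on `Ω`. -/
abbrev dom {d : ℕ} (Ω : Set (Vec d)) : Measure (Vec d) := volume.restrict Ω

/-- The space `[L²(Ω)]^d`. -/
abbrev L2 {d : ℕ} (Ω : Set (Vec d)) : Type := Lp (Vec d) 2 (dom Ω)

/-- The space `[L²(Ω)]^{d × d}`. -/
abbrev L2Mat {d : ℕ} (Ω : Set (Vec d)) : Type := Lp (Mat d) 2 (dom Ω)

/-! ### The velocity space -/

/-- The classical Jacobian matrix: the entry `(j, i)` is `∂ψ_j / ∂x_i`. -/
def jacobian {d : ℕ} (ψ : Vec d → Vec d) (x : Vec d) : Mat d :=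
  WithLp.toLp 2 fun p => fderiv ℝ ψ x (EuclideanSpace.single p.2 1) p.1

/-- `ψ` is a test field: smooth with compact support in `Ω`. -/
structure IsTestField {d : ℕ} (Ω : Set (Vec d)) (ψ : Vec d → Vec d) : Prop where
  smooth : ContDiff ℝ ∞ ψ
  compact : HasCompactSupport ψ
  support : tsupport ψ ⊆ Ω

/-- The space `[H¹₀(Ω)]^d`, as the closure of the test fields in the `H¹` norm.
A field `u` is stored together with its weak gradient, as the pair `(u, ∇u)` in
`L² × L²`, whose Hilbert norm `(‖u‖² + ‖∇u‖²)^{1/2}` is the `H¹` norm. The pairs `(ψ, ∇ψ)` with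
`ψ` a test field form a linear subspace, and in its closure the second component is the weak
gradient of the first, hence is determined by it. -/
def H10 {d : ℕ} (Ω : Set (Vec d)) : Submodule ℝ (WithLp 2 (L2 Ω × L2Mat Ω)) :=
  (Submodule.span ℝ {U | ∃ ψ : Vec d → Vec d, IsTestField Ω ψ ∧
    U.fst =ᵐ[dom Ω] ψ ∧ U.snd =ᵐ[dom Ω] jacobian ψ}).topologicalClosure

/-- A field of `H¹₀` as an element of `L²`. -/
def vel {d : ℕ} {Ω : Set (Vec d)} (u : H10 Ω) : L2 Ω := (u : WithLp 2 (L2 Ω × L2Mat Ω)).fst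

/-- The weak gradient of a field of `H¹₀`; the entry `(j, i)` is `∂u_j / ∂x_i`. -/
def grad {d : ℕ} {Ω : Set (Vec d)} (u : H10 Ω) : L2Mat Ω :=
  (u : WithLp 2 (L2 Ω × L2Mat Ω)).snd

/-- The inner product `(∇u, ∇v)` of `H¹₀`. -/
def gradInner {d : ℕ} {Ω : Set (Vec d)} (u v : H10 Ω) : ℝ := inner ℝ (grad u) (grad v)

/-- The norm of `H⁻¹`, the dual of `H¹₀`, with respect to the norm `‖∇v‖` of `H¹₀`. -/
def dualNorm {d : ℕ} {Ω : Set (Vec d)} (f : StrongDual ℝ (H10 Ω)) : ℝ :=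
  sSup {c : ℝ | ∃ v : H10 Ω, ‖grad v‖ ≤ 1 ∧ c = |f v|}

/-! ### The convective terms -/

/-- The convective derivative `u · ∇v`, with components `∑ i, u_i ∂v_j / ∂x_i`. -/
def conv {d : ℕ} {Ω : Set (Vec d)} (u v : H10 Ω) (x : Vec d) : Vec d :=
  WithLp.toLp 2 fun j => ∑ i, vel u x i * grad v x (j, i)

open Classical in
/-- The convective derivative `u · ∇v` as an element of `L²` (only used when it belongs to `L²`). -/
def convL2 {d : ℕ} {Ω : Set (Vec d)} (u v : H10 Ω) : L2 Ω :=
  if h : MemLp (conv u v) 2 (dom Ω) then h.toLp (conv u v) else 0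

/-- The trilinear form `b(u, v, w) = ½ [(u · ∇v, w) - (u · ∇w, v)]`. -/
def trilinear {d : ℕ} {Ω : Set (Vec d)} (u v w : H10 Ω) : ℝ :=
  (1 / 2) * ((∫ x, inner ℝ (conv u v x) (vel w x) ∂(dom Ω)) -
    ∫ x, inner ℝ (conv u w x) (vel v x) ∂(dom Ω))

/-! ### Meshes and the stabilizing inner product -/

/-- `K` is a nondegenerate simplex or an affine image of the unit cube. -/
def IsMeshCell {d : ℕ} (K : Set (Vec d)) : Prop :=
  (∃ p : Fin (d + 1) → Vec d, AffineIndependent ℝ p ∧ K = convexHull ℝ (Set.range p)) ∨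
  (∃ (a : Vec d) (e : Fin d → Vec d), LinearIndependent ℝ e ∧
    K = (fun x => a + x) '' parallelepiped e)

/-- A conforming triangulation of the closure of `Ω`: any two distinct cells meet in a common face,
which may be empty. -/
structure IsTriangulation {d : ℕ} (Ω : Set (Vec d)) (cells : Finset (Set (Vec d))) : Prop where
  cell : ∀ K ∈ cells, IsMeshCell K
  cover : (⋃ K ∈ cells, K) = closure Ω
  conforming : ∀ K ∈ cells, ∀ K' ∈ cells, K ≠ K' →
    IsExposed ℝ K (K ∩ K') ∧ IsExposed ℝ K' (K ∩ K')

/-- `(g, h)_τ = ∑_K τ_K (g, h)_K`. -/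
def tauInner {d : ℕ} {Ω : Set (Vec d)} (cells : Finset (Set (Vec d))) (τ : Set (Vec d) → ℝ)
    (g h : L2 Ω) : ℝ :=
  ∑ K ∈ cells, τ K * ∫ x in K, inner ℝ (g x) (h x) ∂(dom Ω)

/-- `‖g‖_τ = (g, g)_τ^{1/2}`. -/
def tauNorm {d : ℕ} {Ω : Set (Vec d)} (cells : Finset (Set (Vec d))) (τ : Set (Vec d) → ℝ)
    (g : L2 Ω) : ℝ :=
  √(tauInner cells τ g g)

/-! ### Proper orthogonal decomposition -/

/-- The correlation matrix of the snapshots `Y` for the inner product `ip`. -/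
def correlationMatrix {H : Type*} (ip : H → H → ℝ) {S : ℕ} (Y : Fin S → H) :
    Matrix (Fin S) (Fin S) ℝ :=
  Matrix.of fun m n => (1 / (S : ℝ)) * ip (Y n) (Y m)

/-- `φ` consists of the first `r` POD modes of the snapshots `Y` for the inner product `ip`. Here `z`
is an orthonormal basis of eigenvectors of the correlation matrix and `lam` lists its eigenvalues in
descending order, the first `r` of them being positive. The factor makes the modes orthonormal
for `ip`. -/
def IsPODBasis {H : Type*} [AddCommGroup H] [Module ℝ H] (ip : H → H → ℝ) {S r : ℕ}
    (Y : Fin S → H) (φ : Fin r → H) : Prop :=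
  ∃ (z : OrthonormalBasis (Fin S) ℝ (EuclideanSpace ℝ (Fin S))) (lam : Fin S → ℝ) (hr : r ≤ S),
    Antitone lam ∧
    (∀ i, (correlationMatrix ip Y).mulVec (z i).ofLp = lam i • (z i).ofLp) ∧
    ∀ i : Fin r, 0 < lam (Fin.castLE hr i) ∧
      φ i = (1 / √((S : ℝ) * lam (Fin.castLE hr i))) • ∑ n, z (Fin.castLE hr i) n • Y n

instance finiteDimensional_span_modes {d : ℕ} {Ω : Set (Vec d)} {R : ℕ} (φ : Fin R → L2 Ω) :
    FiniteDimensional ℝ (Submodule.span ℝ (Set.range φ)) :=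
  FiniteDimensional.span_of_finite ℝ (Set.finite_range φ)

/-- The operator `I - P`, with `P` the `L²`-orthogonal projection on the span of `φ`. -/
def highPass {d : ℕ} {Ω : Set (Vec d)} {R : ℕ} (φ : Fin R → L2 Ω) (g : L2 Ω) : L2 Ω :=
  g - (Submodule.span ℝ (Set.range φ)).starProjection g

/-! ### The fully discrete reduced order model -/

/-- The stabilized convective derivative `P'_R (u · ∇v)`. -/
def highConv {d : ℕ} {Ω : Set (Vec d)} {R : ℕ} (φhat : Fin R → L2 Ω) (u v : H10 Ω) : L2 Ω :=
  highPass φhat (convL2 u v)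

/-- One fully implicit time step: given the old velocity `v` and the force `f` at the new time, the
new velocity `w` solves the reduced order model on the span of `φ`. -/
def IsStep {d : ℕ} {Ω : Set (Vec d)} (cells : Finset (Set (Vec d))) (τ : Set (Vec d) → ℝ)
    {r R : ℕ} (φ : Fin r → H10 Ω) (φhat : Fin R → L2 Ω) (ν Δt : ℝ)
    (f : StrongDual ℝ (H10 Ω)) (v w : H10 Ω) : Prop :=
  w ∈ Submodule.span ℝ (Set.range φ) ∧
  ∀ ψ ∈ Submodule.span ℝ (Set.range φ),
    inner ℝ (Δt⁻¹ • (vel w - vel v)) (vel ψ) + trilinear w w ψ + ν * gradInner w ψ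
      + tauInner cells τ (highConv φhat w w) (highConv φhat w ψ) = f ψ

/-- The initial value `∑ i, (∇u⁰, ∇φ_i) φ_i`, the elliptic projection of `u⁰`. -/
def initialValue {d : ℕ} {Ω : Set (Vec d)} {r : ℕ} (φ : Fin r → H10 Ω) (u0 : H10 Ω) : H10 Ω :=
  ∑ i, gradInner u0 (φ i) • φ i

/-- `u 0, …, u N` solves the discrete reduced order model with time step `Δt`; the force in the step
from `n` to `n + 1` is taken at the time `(n + 1) Δt`. -/
def IsSolution {d : ℕ} {Ω : Set (Vec d)} (cells : Finset (Set (Vec d))) (τ : Set (Vec d) → ℝ)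
    {r R : ℕ} (φ : Fin r → H10 Ω) (φhat : Fin R → L2 Ω) (ν Δt : ℝ) (N : ℕ)
    (f : ℝ → StrongDual ℝ (H10 Ω)) (u0 : H10 Ω) (u : ℕ → H10 Ω) : Prop :=
  u 0 = initialValue φ u0 ∧
  ∀ n < N, IsStep cells τ φ φhat ν Δt (f (((n : ℝ) + 1) * Δt)) (u n) (u (n + 1))

end

end SDPODROM

/-! Stability is the energy estimate: in a step tested with its own solution the skew convective
form vanishes and the stabilization is nonnegative, so Young's inequality absorbs half of the
viscous term, and the balances of the steps add up (`IsStep.energy`).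

For existence, the residual of a step is a smooth vector field on the finite-dimensional span of the
modes. By the same cancellations it is coercive, since a Poincaré inequality (`exists_norm_vel_le`)
bounds the full norm by the gradient, so it points outwards far from the origin. Such a field has a
zero (`exists_eq_zero_of_inner_pos`), a form of Brouwer's theorem derived from the absence of a C¹
retraction onto the sphere. That absence follows from `integral_det_fderiv_eq_of_eq_id_on_sphere`: a
C¹ map fixing the sphere has Jacobian integral equal to the volume of the ball, whereas the Jacobian
of a retraction vanishes. -/

namespace SDPODROM

/-! ### Zeros of outward-pointing vector fields. -/

section Brouwer

open Set Metric Filter Topology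

/-- Lagrange interpolation at nodes near 0, extrapolated to 1. The weights do not depend on `q`, so
the formula can be applied pointwise under an integral. -/
theorem exists_interpolation_weights (n : ℕ) {δ : ℝ} (hδ : 0 < δ) :
    ∃ (t w : Fin (n + 1) → ℝ), (∀ i, 0 < t i ∧ t i < δ) ∧
      ∀ q : Polynomial ℝ, q.natDegree ≤ n → q.eval 1 = ∑ i, w i * q.eval (t i) := by
  let t : Fin (n + 1) → ℝ := fun i => δ / ((i : ℕ) + 2)
  have hinj : Set.InjOn t (Finset.univ : Finset (Fin (n + 1))) := by
    intro i _ j _ hij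
    have h1 : (0 : ℝ) < (i : ℕ) + 2 := by positivity
    have h2 : (0 : ℝ) < (j : ℕ) + 2 := by positivity
    have h3 : δ * ((j : ℕ) + 2) = δ * ((i : ℕ) + 2) := (div_eq_div_iff h1.ne' h2.ne').1 hij
    have h4 := mul_left_cancel₀ hδ.ne' h3
    apply Fin.ext
    exact_mod_cast (add_right_cancel h4).symm
  refine ⟨t, fun i => (Lagrange.basis Finset.univ t i).eval 1, fun i => ⟨by positivity, ?_⟩, ?_⟩
  · apply div_lt_self hδ
    have : (0 : ℝ) ≤ (i : ℕ) := by positivity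
    linarith
  · intro q hq
    have hdeg : q.degree < (Finset.univ : Finset (Fin (n + 1))).card := by
      rw [Finset.card_univ, Fintype.card_fin]
      exact lt_of_le_of_lt Polynomial.degree_le_natDegree (by exact_mod_cast Nat.lt_succ_of_le hq)
    conv_lhs => rw [Lagrange.eq_interpolate hinj hdeg]
    rw [Lagrange.interpolate_apply, Polynomial.eval_finsetSum]
    exact Finset.sum_congr rfl fun i _ => by simp [mul_comm]

variable {E : Type*} [NormedAddCommGroup E] [InnerProductSpace ℝ E] [FiniteDimensional ℝ E]

theorem exists_polynomial_det_one_add_smul (A : E →L[ℝ] E) :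
    ∃ q : Polynomial ℝ, q.natDegree ≤ Module.finrank ℝ E ∧
      ∀ t : ℝ, (ContinuousLinearMap.id ℝ E + t • A).det = q.eval t := by
  let b := Module.finBasis ℝ E
  let M := LinearMap.toMatrix b b (A : E →ₗ[ℝ] E)
  refine ⟨Matrix.det ((Polynomial.X : Polynomial ℝ) • M.map Polynomial.C +
    (1 : Matrix _ _ ℝ).map Polynomial.C), ?_, fun t => ?_⟩
  · simpa using Polynomial.natDegree_det_X_add_C_le M 1
  · rw [ContinuousLinearMap.det, ← LinearMap.det_toMatrix b, ← Polynomial.coe_evalRingHom,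
      RingHom.map_det]
    congr 1
    ext i j
    have h1 : b.repr (b j) i = (1 : Matrix _ _ ℝ) i j := by
      simp [Matrix.one_apply, Finsupp.single_apply, eq_comm]
    have h2 : (Polynomial.C ((1 : Matrix (Fin (Module.finrank ℝ E)) _ ℝ) i j)).eval t =
        (1 : Matrix _ _ ℝ) i j := Polynomial.eval_C
    simp only [LinearMap.toMatrix_apply, M, ContinuousLinearMap.coe_coe, add_apply,
      ContinuousLinearMap.id_apply, smul_apply, map_add, map_smul,
      Finsupp.add_apply, Finsupp.smul_apply, smul_eq_mul, RingHom.mapMatrix_apply,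
      Matrix.map_apply, Matrix.add_apply, Matrix.smul_apply, Polynomial.coe_evalRingHom,
      Polynomial.eval_mul, Polynomial.eval_X, Polynomial.eval_C, h1]
    ring

/-- Along the segment from the identity the operators stay injective, so the determinant keeps the
sign it has at the identity. -/
theorem det_one_add_pos {A : E →L[ℝ] E} (hA : ‖A‖ < 1) :
    0 < (ContinuousLinearMap.id ℝ E + A).det := by
  have hne : ∀ s ∈ Icc (0 : ℝ) 1, (ContinuousLinearMap.id ℝ E + s • A).det ≠ 0 := by
    intro s hs h0
    obtain ⟨v, hv, hv0⟩ : ∃ v : E, (ContinuousLinearMap.id ℝ E + s • A) v = 0 ∧ v ≠ 0 := by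
      obtain ⟨v, hv, hv0⟩ := (Submodule.ne_bot_iff _).1
        (bot_lt_iff_ne_bot.1 (LinearMap.bot_lt_ker_of_det_eq_zero h0))
      exact ⟨v, hv, hv0⟩
    have h1 : v = -(s • A v) := by
      have : v + s • A v = 0 := by simpa using hv
      exact eq_neg_of_add_eq_zero_left this
    have h2 : ‖v‖ ≤ ‖A‖ * ‖v‖ := by
      calc ‖v‖ = ‖s • A v‖ := by conv_lhs => rw [h1, norm_neg]
        _ = |s| * ‖A v‖ := norm_smul _ _
        _ ≤ 1 * ‖A v‖ := by
          gcongr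
          rw [abs_of_nonneg hs.1]; exact hs.2
        _ ≤ ‖A‖ * ‖v‖ := by rw [one_mul]; exact A.le_opNorm v
    have h3 : 0 < ‖v‖ := norm_pos_iff.2 hv0
    nlinarith
  have hcont : ContinuousOn (fun s : ℝ => (ContinuousLinearMap.id ℝ E + s • A).det) (Icc 0 1) := by
    refine (ContinuousLinearMap.continuous_det.comp ?_).continuousOn
    fun_prop
  by_contra hle
  have hmem : (0 : ℝ) ∈ Icc ((ContinuousLinearMap.id ℝ E + (1 : ℝ) • A).det)
      ((ContinuousLinearMap.id ℝ E + (0 : ℝ) • A).det) := by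
    refine ⟨by simpa using hle, ?_⟩
    simp [ContinuousLinearMap.det]
  obtain ⟨s, hs, hs0⟩ := intermediate_value_Icc' zero_le_one hcont hmem
  exact hne s hs hs0

omit [FiniteDimensional ℝ E] in
-- A segment leaving the ball crosses the sphere, where `h` vanishes; comparing with the crossing
-- point costs no extra constant.
theorem lipschitzWith_indicator_closedBall {h : E → E} {K : NNReal} {R : ℝ}
    (hh : LipschitzOnWith K h (closedBall 0 R)) (h0 : ∀ x, ‖x‖ = R → h x = 0) :
    LipschitzWith K ((closedBall (0 : E) R).indicator h) := by
  have key : ∀ x y : E, x ∈ closedBall (0 : E) R → y ∉ closedBall (0 : E) R →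
      dist (h x) 0 ≤ K * dist x y := by
    intro x y hx hy
    rw [mem_closedBall_zero_iff] at hx hy
    push Not at hy
    obtain ⟨s, hs, hsR⟩ := intermediate_value_Icc (zero_le_one (α := ℝ))
      (f := fun s : ℝ => ‖AffineMap.lineMap (k := ℝ) x y s‖)
      AffineMap.lineMap_continuous.norm.continuousOn
      (show R ∈ _ by simpa using ⟨hx, hy.le⟩)
    set z := AffineMap.lineMap (k := ℝ) x y s
    have hz : dist x z ≤ dist x y := by
      rw [dist_comm, dist_lineMap_left, Real.norm_of_nonneg hs.1]
      nlinarith [hs.2, dist_nonneg (x := x) (y := y)]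
    calc dist (h x) 0 = dist (h x) (h z) := by rw [h0 z hsR]
      _ ≤ K * dist x z := hh.dist_le_mul x (by simpa using hx) z
          (by simpa using le_of_eq hsR)
      _ ≤ K * dist x y := by gcongr
  refine LipschitzWith.of_dist_le_mul fun x y => ?_
  by_cases hx : x ∈ closedBall (0 : E) R <;> by_cases hy : y ∈ closedBall (0 : E) R
  · simpa [indicator_of_mem hx, indicator_of_mem hy] using hh.dist_le_mul x hx y hy
  · rw [indicator_of_mem hx, indicator_of_notMem hy]
    exact key x y hx hy
  · rw [indicator_of_mem hy, indicator_of_notMem hx, dist_comm, dist_comm x y]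
    exact key y x hy hx
  · simp only [indicator_of_notMem hx, indicator_of_notMem hy, dist_self]
    positivity

theorem bijective_add_of_lipschitzWith {g : E → E} {c : NNReal} (hc : c < 1)
    (hg : LipschitzWith c g) : Function.Bijective fun x => x + g x := by
  have happ : ApproximatesLinearOn (fun x => x + g x)
      ((ContinuousLinearEquiv.refl ℝ E : E ≃L[ℝ] E) : E →L[ℝ] E) univ c := by
    intro x _ y _
    have : x + g x - (y + g y) - (x - y) = g x - g y := by abel
    simpa [this] using hg.norm_sub_le x y
  have hN : Subsingleton E ∨
      c < ‖((ContinuousLinearEquiv.refl ℝ E).symm : E →L[ℝ] E)‖₊⁻¹ := by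
    rcases subsingleton_or_nontrivial E with h | h
    · exact Or.inl h
    · right
      have : ‖((ContinuousLinearEquiv.refl ℝ E).symm : E →L[ℝ] E)‖₊ = 1 := by
        rw [← NNReal.coe_inj]
        exact ContinuousLinearMap.norm_id
      rw [this]
      simpa using hc
  exact ⟨fun x y hxy => happ.injOn hN (mem_univ x) (mem_univ y) hxy, happ.surjective hN⟩

variable [MeasurableSpace E] [BorelSpace E] (μ : Measure E) [μ.IsAddHaarMeasure]

/-- For small `t > 0` the map `x + t (f x - x)`, extended by the identity, is a bijection that
preserves the ball and has positive Jacobian, so its Jacobian integral is the volume. Being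
polynomial in `t`, this integral has the same value at `t = 1`. -/
theorem integral_det_fderiv_eq_of_eq_id_on_sphere {f : E → E} {R : ℝ}
    (hf : ∀ x ∈ closedBall (0 : E) R, ContDiffAt ℝ 1 f x)
    (hid : ∀ x, ‖x‖ = R → f x = x) :
    ∫ x in closedBall (0 : E) R, (fderiv ℝ f x).det ∂μ = μ.real (closedBall 0 R) := by
  set B := closedBall (0 : E) R with hB
  have hBc : IsCompact B := isCompact_closedBall 0 R
  let A : E → E →L[ℝ] E := fun x => fderiv ℝ f x - ContinuousLinearMap.id ℝ E
  have hA : ContinuousOn A B := fun x hx =>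
    (((hf x hx).fderiv_right (m := 0) le_rfl).continuousAt.sub continuousAt_const).continuousWithinAt
  obtain ⟨K, hK⟩ : ∃ K : NNReal, ∀ x ∈ B, ‖A x‖₊ ≤ K := by
    obtain ⟨C, hC⟩ := hBc.exists_bound_of_continuousOn hA
    exact ⟨C.toNNReal, fun x hx => NNReal.le_toNNReal_of_coe_le (hC x hx)⟩
  have hderiv : ∀ x ∈ B, HasFDerivAt (fun y => f y - y) (A x) x := fun x hx =>
    (((hf x hx).differentiableAt one_ne_zero).hasFDerivAt).sub (hasFDerivAt_id x)
  have hlip : LipschitzOnWith K (fun y => f y - y) B :=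
    (convex_closedBall 0 R).lipschitzOnWith_of_nnnorm_hasFDerivWithin_le
      (fun x hx => (hderiv x hx).hasFDerivWithinAt) hK
  have hglip : LipschitzWith K (B.indicator fun y => f y - y) :=
    lipschitzWith_indicator_closedBall hlip fun x hx => by simp [hid x hx]
  set g := B.indicator fun y => f y - y with hg
  have hsmall : ∀ t : ℝ, 0 < t → t < 1 / (K + 1) →
      ∫ x in B, (ContinuousLinearMap.id ℝ E + t • A x).det ∂μ = μ.real B := by
    intro t ht0 ht
    have htK : t * K < 1 := by
      have hK0 : (0 : ℝ) ≤ K := K.2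
      rw [lt_div_iff₀ (by positivity)] at ht
      nlinarith
    have hbij : Function.Bijective fun x => x + t • g x := by
      refine bijective_add_of_lipschitzWith (c := ‖t‖₊ * K) ?_ (lipschitzWith_iff_norm_sub_le.2 ?_)
      · rw [← NNReal.coe_lt_coe]
        simpa [abs_of_pos ht0] using htK
      · intro x y
        rw [← smul_sub, norm_smul, NNReal.coe_mul, mul_assoc]
        exact mul_le_mul_of_nonneg_left (hglip.norm_sub_le x y) (norm_nonneg t)
    have hout : ∀ x ∉ B, x + t • g x = x := fun x hx => by simp [hg, indicator_of_notMem hx]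
    -- A global bijection that fixes every point outside `B` must permute `B`.
    have himage : (fun x => x + t • g x) '' B = B := by
      apply Subset.antisymm
      · rintro _ ⟨x, hx, rfl⟩
        by_contra hcon
        have := hbij.1 (hout _ hcon)
        simp only at this hcon
        rw [this] at hcon
        exact hcon hx
      · intro y hy
        obtain ⟨x, rfl⟩ := hbij.2 y
        refine ⟨x, ?_, rfl⟩
        by_contra hx
        simp only [hout x hx] at hy
        exact hx hy
    have hD : ∀ x ∈ B, HasFDerivWithinAt (fun x => x + t • g x)
        (ContinuousLinearMap.id ℝ E + t • A x) B x := by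
      intro x hx
      have h1 : HasFDerivWithinAt (fun y => y + t • (f y - y))
          (ContinuousLinearMap.id ℝ E + t • A x) B x :=
        ((hasFDerivAt_id x).add ((hderiv x hx).const_smul t)).hasFDerivWithinAt
      refine h1.congr (fun y hy => ?_) ?_
      · simp [hg, indicator_of_mem hy]
      · simp [hg, indicator_of_mem hx]
    have hcv := integral_image_eq_integral_abs_det_fderiv_smul μ hBc.measurableSet hD
      hbij.1.injOn (fun _ => (1 : ℝ))
    rw [himage] at hcv
    simp only [smul_eq_mul, mul_one, integral_const, MeasurableSet.univ, measureReal_restrict_apply,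
      univ_inter] at hcv
    rw [hcv]
    refine setIntegral_congr_fun hBc.measurableSet fun x hx => ?_
    refine (abs_of_pos (det_one_add_pos ?_)).symm
    rw [norm_smul, Real.norm_of_nonneg ht0.le]
    exact lt_of_le_of_lt (mul_le_mul_of_nonneg_left (hK x hx) ht0.le) htK
  obtain ⟨t, w, ht, hw⟩ := exists_interpolation_weights (Module.finrank ℝ E)
    (δ := 1 / ((K : ℝ) + 1)) (by positivity)
  have hpt : ∀ x, (fderiv ℝ f x).det =
      ∑ i, w i * (ContinuousLinearMap.id ℝ E + t i • A x).det := by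
    intro x
    obtain ⟨q, hq, hqe⟩ := exists_polynomial_det_one_add_smul (A x)
    have h1 : fderiv ℝ f x = ContinuousLinearMap.id ℝ E + (1 : ℝ) • A x := by simp [A]
    rw [h1, hqe, hw q hq]
    exact Finset.sum_congr rfl fun i _ => by rw [hqe]
  have hint : ∀ i, IntegrableOn
      (fun x => w i * (ContinuousLinearMap.id ℝ E + t i • A x).det) B μ := by
    intro i
    refine ContinuousOn.integrableOn_compact hBc (continuousOn_const.mul ?_)
    exact ContinuousLinearMap.continuous_det.comp_continuousOn
      (continuousOn_const.add (hA.const_smul (t i)))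
  have hsum : ∑ i, w i = 1 := by
    have := hw 1 (by simp)
    simpa using this.symm
  simp_rw [hpt]
  rw [integral_finsetSum _ fun i _ => hint i]
  simp_rw [integral_const_mul, fun i => hsmall (t i) (ht i).1 (ht i).2]
  rw [← Finset.sum_mul, hsum, one_mul]

omit [MeasurableSpace E] [BorelSpace E] in
-- Differentiating the constant squared norm shows that the range of the derivative is orthogonal to
-- the nonzero vector `f x`, so the derivative is not onto.
theorem det_fderiv_eq_zero_of_norm_eventually_const {f : E → E} {R : ℝ} (hR : 0 < R) {x : E}
    (hf : DifferentiableAt ℝ f x) (h : ∀ᶠ y in 𝓝 x, ‖f y‖ = R) : (fderiv ℝ f x).det = 0 := by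
  have hperp : ∀ v, inner ℝ (f x) (fderiv ℝ f x v) = 0 := by
    intro v
    have h1 := (hf.hasFDerivAt.norm_sq).unique
      ((hasFDerivAt_const (R ^ 2) x).congr_of_eventuallyEq
        (h.mono fun y hy => by simp only [hy]))
    simpa using congrArg (fun L => L v) h1
  by_contra hdet
  obtain ⟨v, hv⟩ : ∃ v, fderiv ℝ f x v = f x := by
    have hsurj := (LinearMap.equivOfDetNeZero (fderiv ℝ f x : E →ₗ[ℝ] E) hdet).surjective
    obtain ⟨v, hv⟩ := hsurj (f x)
    exact ⟨v, hv⟩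
  have h2 := hperp v
  rw [hv, inner_self_eq_zero] at h2
  have h3 := h.self_of_nhds
  rw [h2, norm_zero] at h3
  exact hR.ne h3

omit [MeasurableSpace E] [BorelSpace E] in
/-- There is no `C¹` retraction of a ball onto its boundary sphere. -/
theorem not_retraction_onto_sphere {f : E → E} {R : ℝ} (hR : 0 < R)
    (hf : ∀ x ∈ closedBall (0 : E) R, ContDiffAt ℝ 1 f x)
    (hid : ∀ x, ‖x‖ = R → f x = x)
    (hsph : ∀ x ∈ closedBall (0 : E) R, ∀ᶠ y in 𝓝 x, ‖f y‖ = R) : False := by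
  let _ : MeasurableSpace E := borel E
  have _ : BorelSpace E := ⟨rfl⟩
  have h1 := integral_det_fderiv_eq_of_eq_id_on_sphere Measure.addHaar hf hid
  rw [setIntegral_congr_fun (g := fun _ => (0 : ℝ)) measurableSet_closedBall fun x hx =>
    det_fderiv_eq_zero_of_norm_eventually_const hR
      ((hf x hx).differentiableAt one_ne_zero) (hsph x hx), integral_zero] at h1
  have h2 : 0 < (Measure.addHaar (G := E)).real (closedBall (0 : E) R) :=
    ENNReal.toReal_pos (measure_closedBall_pos _ _ hR).ne' measure_closedBall_lt_top.ne
  exact h2.ne h1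

omit [MeasurableSpace E] [BorelSpace E] in
/-- A `C¹` vector field that points outwards outside a ball has a zero. -/
theorem exists_eq_zero_of_inner_pos {F : E → E} (hF : ContDiff ℝ 1 F) {ρ : ℝ} (hρ : 0 < ρ)
    (hpos : ∀ x, ρ ≤ ‖x‖ → 0 < inner ℝ (F x) x) : ∃ x, F x = 0 := by
  by_contra! hne
  obtain ⟨m, hm0, hm⟩ : ∃ m : ℝ, 0 < m ∧ ∀ x ∈ closedBall (0 : E) ρ, m ≤ ‖F x‖ := by
    obtain ⟨x, hx, hmin⟩ := (isCompact_closedBall (0 : E) ρ).exists_isMinOn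
      ⟨0, by simp [hρ.le]⟩ hF.continuous.norm.continuousOn
    exact ⟨‖F x‖, norm_pos_iff.2 (hne x), fun y hy => hmin hy⟩
  -- Up to the factor `(2ρ)²`, a convex combination of `x` and `(ρ / m) F x` that is `x` on the
  -- sphere of radius `2ρ`. For `ρ ≤ ‖x‖ ≤ 2ρ` it pairs positively with `x`; for `‖x‖ < ρ` the `F`
  -- term has norm above `3ρ³` and dominates `‖x‖³`. Hence it can be normalized to a retraction.
  let G : E → E := fun x => ‖x‖ ^ 2 • x + (ρ / m * ((2 * ρ) ^ 2 - ‖x‖ ^ 2)) • F x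
  have hG : ContDiff ℝ 1 G :=
    ((contDiff_norm_sq ℝ).smul contDiff_id).add
      ((contDiff_const.mul (contDiff_const.sub (contDiff_norm_sq ℝ))).smul hF)
  have hG0 : ∀ x ∈ closedBall (0 : E) (2 * ρ), G x ≠ 0 := by
    intro x hx hx0
    rw [mem_closedBall_zero_iff] at hx
    have hsq : 0 ≤ (2 * ρ) ^ 2 - ‖x‖ ^ 2 := by nlinarith [norm_nonneg x]
    rcases le_or_gt ρ ‖x‖ with h | h
    · have h1 : inner ℝ (G x) x = ‖x‖ ^ 2 * ‖x‖ ^ 2 +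
          (ρ / m * ((2 * ρ) ^ 2 - ‖x‖ ^ 2)) * inner ℝ (F x) x := by
        simp [G, inner_add_left, real_inner_smul_left]
      have h2 := hpos x h
      have h3 : 0 < ‖x‖ := hρ.trans_le h
      rw [hx0, inner_zero_left] at h1
      have : 0 < ‖x‖ ^ 2 * ‖x‖ ^ 2 +
          (ρ / m * ((2 * ρ) ^ 2 - ‖x‖ ^ 2)) * inner ℝ (F x) x := by positivity
      exact this.ne h1
    · have h1 : ‖‖x‖ ^ 2 • x‖ = ‖(ρ / m * ((2 * ρ) ^ 2 - ‖x‖ ^ 2)) • F x‖ := by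
        rw [eq_neg_of_add_eq_zero_left hx0, norm_neg]
      have hcoef : 0 ≤ ρ / m * ((2 * ρ) ^ 2 - ‖x‖ ^ 2) := by positivity
      rw [norm_smul, norm_smul, Real.norm_of_nonneg hcoef, Real.norm_of_nonneg (by positivity)] at h1
      have h2 := hm x (by simpa using h.le)
      have h3 : ρ * ((2 * ρ) ^ 2 - ‖x‖ ^ 2) ≤
          ρ / m * ((2 * ρ) ^ 2 - ‖x‖ ^ 2) * ‖F x‖ := by
        calc ρ * ((2 * ρ) ^ 2 - ‖x‖ ^ 2) = ρ / m * ((2 * ρ) ^ 2 - ‖x‖ ^ 2) * m := by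
              field_simp
          _ ≤ _ := by gcongr
      have h4 : ‖x‖ ^ 2 < ρ ^ 2 := by gcongr
      have h5 : ‖x‖ ^ 2 * ‖x‖ ≤ ρ ^ 2 * ρ := by gcongr
      nlinarith
  refine not_retraction_onto_sphere (f := fun x => (2 * ρ / ‖G x‖) • G x) (R := 2 * ρ)
    (by positivity) (fun x hx => ?_) (fun x hx => ?_) (fun x hx => ?_)
  · have hn : ContDiffAt ℝ 1 (fun y => ‖G y‖) x := hG.contDiffAt.norm ℝ (hG0 x hx)
    exact (contDiffAt_const.div hn (norm_ne_zero_iff.2 (hG0 x hx))).smul hG.contDiffAt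
  · have h1 : G x = (2 * ρ) ^ 2 • x := by simp [G, hx]
    have h2 : ‖G x‖ = (2 * ρ) ^ 2 * (2 * ρ) := by
      rw [h1, norm_smul, hx, Real.norm_of_nonneg (by positivity)]
    simp only [h2]
    rw [h1, smul_smul]
    have : 2 * ρ / ((2 * ρ) ^ 2 * (2 * ρ)) * (2 * ρ) ^ 2 = 1 := by field_simp
    rw [this, one_smul]
  · filter_upwards [hG.continuous.continuousAt.eventually_ne (hG0 x hx)] with y hy
    rw [norm_smul, Real.norm_of_nonneg (by positivity)]
    exact div_mul_cancel₀ _ (norm_ne_zero_iff.2 hy)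

end Brouwer

/-! ### The nonlinear system of one time step. -/

/-- Solvability of the Galerkin equations of a stabilized implicit step, with convection `C`,
stabilization `B` and force `f`. -/
theorem exists_galerkin_step {V L M : Type*} [NormedAddCommGroup V] [InnerProductSpace ℝ V]
    [FiniteDimensional ℝ V] [NormedAddCommGroup L] [InnerProductSpace ℝ L]
    [NormedAddCommGroup M] [InnerProductSpace ℝ M]
    (p : V →L[ℝ] L) (D : V →L[ℝ] M) (C : V →L[ℝ] V →L[ℝ] L) (B : L →L[ℝ] L →L[ℝ] ℝ)
    (hB : ∀ g, 0 ≤ B g g) (f : V →L[ℝ] ℝ) (v : L) {a ν c : ℝ} (ha : 0 ≤ a) (hν : 0 < ν)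
    (hc : 0 < c) (hD : ∀ x, c * ‖x‖ ≤ ‖D x‖) :
    ∃ w : V, ∀ ψ : V, inner ℝ (a • (p w - v)) (p ψ)
      + (1 / 2) * (inner ℝ (C w w) (p ψ) - inner ℝ (C w ψ) (p w))
      + ν * inner ℝ (D w) (D ψ) + B (C w w) (C w ψ) = f ψ := by
  let res : V → V →L[ℝ] ℝ := fun w =>
    (innerSL ℝ (a • (p w - v))).comp p
      + (1 / 2 : ℝ) • ((innerSL ℝ (C w w)).comp p - (innerSL ℝ (p w)).comp (C w))
      + ν • (innerSL ℝ (D w)).comp D + (B (C w w)).comp (C w) - f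
  have hres : ∀ w ψ, res w ψ = inner ℝ (a • (p w - v)) (p ψ)
      + (1 / 2) * (inner ℝ (C w w) (p ψ) - inner ℝ (C w ψ) (p w))
      + ν * inner ℝ (D w) (D ψ) + B (C w w) (C w ψ) - f ψ := by
    intro w ψ
    simp [res, real_inner_comm (C w ψ) (p w), real_inner_smul_left,
      inner_sub_left]
  have hsmooth : ContDiff ℝ 1 res := by
    have hC : ContDiff ℝ 1 fun w : V => C w := C.contDiff
    have hCw : ContDiff ℝ 1 fun w : V => C w w := hC.clm_apply contDiff_id
    have hp : ContDiff ℝ 1 fun w : V => p w := p.contDiff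
    have h1 : ContDiff ℝ 1 fun w : V => innerSL ℝ (a • (p w - v)) :=
      (innerSL ℝ (E := L)).contDiff.comp ((hp.sub contDiff_const).const_smul a)
    have h2 : ContDiff ℝ 1 fun w : V => innerSL ℝ (C w w) :=
      (innerSL ℝ (E := L)).contDiff.comp hCw
    have h3 : ContDiff ℝ 1 fun w : V => innerSL ℝ (p w) := (innerSL ℝ (E := L)).contDiff.comp hp
    have h4 : ContDiff ℝ 1 fun w : V => innerSL ℝ (D w) :=
      (innerSL ℝ (E := M)).contDiff.comp D.contDiff
    have h5 : ContDiff ℝ 1 fun w : V => B (C w w) := B.contDiff.comp hCw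
    exact ((((h1.clm_comp contDiff_const).add
      (((h2.clm_comp contDiff_const).sub (h3.clm_comp hC)).const_smul _)).add
      ((h4.clm_comp contDiff_const).const_smul ν)).add (h5.clm_comp hC)).sub contDiff_const
  let F : V → V := fun w => (InnerProductSpace.toDual ℝ V).symm (res w)
  have hFinner : ∀ w ψ, inner ℝ (F w) ψ = res w ψ := fun w ψ =>
    InnerProductSpace.toDual_symm_apply
  have hF : ContDiff ℝ 1 F :=
    (InnerProductSpace.toDual ℝ V).symm.toContinuousLinearEquiv.contDiff.comp hsmooth
  -- `k ‖x‖` bounds the terms without a sign, and `ν c² ‖x‖²` bounds the viscous term from below;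
  -- the extra `1` in the radius makes the comparison strict.
  set k := a * ‖v‖ * ‖p‖ + ‖f‖ with hk
  have hk0 : 0 ≤ k := by positivity
  obtain ⟨w, hw⟩ := exists_eq_zero_of_inner_pos hF (ρ := k / (ν * c ^ 2) + 1) (by positivity) <| by
    intro x hx
    have hx0 : 0 < ‖x‖ := lt_of_lt_of_le (by positivity) hx
    rw [hFinner, hres]
    have h1 : -(a * ‖v‖ * ‖p‖ * ‖x‖) ≤ inner ℝ (a • (p x - v)) (p x) := by
      rw [real_inner_smul_left, inner_sub_left, real_inner_self_eq_norm_sq]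
      have h2 : inner ℝ v (p x) ≤ ‖v‖ * (‖p‖ * ‖x‖) :=
        (real_inner_le_norm _ _).trans (by gcongr; exact p.le_opNorm x)
      have h3 : 0 ≤ a * ‖p x‖ ^ 2 := by positivity
      nlinarith
    have h2 : f x ≤ ‖f‖ * ‖x‖ := (le_abs_self _).trans (f.le_opNorm x)
    have h3 : ν * (c * ‖x‖) ^ 2 ≤ ν * inner ℝ (D x) (D x) := by
      rw [real_inner_self_eq_norm_sq]
      gcongr
      exact hD x
    have h4 := hB (C x x)
    have h5 : k < ν * c ^ 2 * ‖x‖ := by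
      have : k / (ν * c ^ 2) < ‖x‖ := by linarith
      rw [div_lt_iff₀ (by positivity)] at this
      linarith
    have h6 : k * ‖x‖ < ν * c ^ 2 * ‖x‖ * ‖x‖ := by gcongr
    rw [sub_self, mul_zero]
    nlinarith
  refine ⟨w, fun ψ => ?_⟩
  have h1 := hFinner w ψ
  rw [hw, inner_zero_left, hres] at h1
  linarith

/-! ### Poincaré inequality and the dual norm. -/

section Poincare

variable {d : ℕ} {Ω : Set (Vec d)}

theorem norm_fderiv_le_norm_jacobian (ψ : Vec d → Vec d) (x : Vec d) :
    ‖fderiv ℝ ψ x‖ ≤ ‖jacobian ψ x‖ := by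
  refine ContinuousLinearMap.opNorm_le_bound _ (norm_nonneg _) fun v => ?_
  have hcoord : ∀ j, fderiv ℝ ψ x v j = ∑ i, v i * jacobian ψ x (j, i) := by
    intro j
    conv_lhs => rw [← (EuclideanSpace.basisFun (Fin d) ℝ).sum_repr v]
    simp [jacobian]
  rw [← sq_le_sq₀ (norm_nonneg _) (by positivity), mul_pow, EuclideanSpace.real_norm_sq_eq,
    EuclideanSpace.real_norm_sq_eq, EuclideanSpace.real_norm_sq_eq, Fintype.sum_prod_type,
    Finset.sum_mul]
  refine Finset.sum_le_sum fun j _ => ?_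
  rw [hcoord j, mul_comm]
  exact Finset.sum_mul_sq_le_sq_mul_sq _ _ _

/-- The Gagliardo–Nirenberg–Sobolev inequality. It needs `p < d`, which excludes `p = 2` in the
plane; `3 / 2` satisfies this and `1 / p - 1 / d ≤ 1 / 2` in both dimensions. -/
theorem eLpNorm_two_le_of_isTestField (hd : d = 2 ∨ d = 3) (hΩb : Bornology.IsBounded Ω)
    {p : NNReal} (hp : (p : ℝ) = 3 / 2) :
    ∃ C : NNReal, ∀ ψ : Vec d → Vec d, IsTestField Ω ψ →
      eLpNorm ψ 2 volume ≤ C * eLpNorm (fderiv ℝ ψ) p volume := by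
  refine ⟨eLpNormLESNormFDerivOfLeConst (Vec d) (volume : Measure (Vec d)) Ω p 2,
    fun ψ hψ => ?_⟩
  have hsmooth : ContDiff ℝ 1 ψ := hψ.smooth.of_le (by exact_mod_cast le_top)
  refine eLpNorm_le_eLpNorm_fderiv_of_le (q := 2) volume hsmooth
    ((subset_tsupport ψ).trans hψ.support) ?_ ?_ ?_ hΩb
  · rw [← NNReal.coe_le_coe, hp]; norm_num
  · rw [finrank_euclideanSpace_fin, ← NNReal.coe_lt_coe, hp]
    rcases hd with rfl | rfl <;> norm_num
  · rw [finrank_euclideanSpace_fin, NNReal.coe_inv, hp]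
    rcases hd with rfl | rfl <;> norm_num

/-- Hölder's inequality on the bounded set raises the gradient exponent from `3 / 2` to `2`. -/
theorem eLpNorm_testField_le (hd : d = 2 ∨ d = 3) (hΩb : Bornology.IsBounded Ω) :
    ∃ C : NNReal, ∀ ψ : Vec d → Vec d, IsTestField Ω ψ →
      eLpNorm ψ 2 (dom Ω) ≤ C * eLpNorm (jacobian ψ) 2 (dom Ω) := by
  obtain ⟨p, hp⟩ : ∃ p : NNReal, (p : ℝ) = 3 / 2 :=
    ⟨Real.toNNReal (3 / 2), Real.coe_toNNReal _ (by norm_num)⟩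
  obtain ⟨C₀, hC₀⟩ := eLpNorm_two_le_of_isTestField hd hΩb hp
  have hvol : volume Ω ≠ ⊤ := hΩb.measure_lt_top.ne
  have hp2 : (p : ENNReal) ≤ 2 := by
    rw [← ENNReal.coe_ofNat, ENNReal.coe_le_coe, ← NNReal.coe_le_coe, hp]
    norm_num
  obtain ⟨C₁, hC₁⟩ : ∃ C₁ : NNReal,
      (dom Ω) Set.univ ^ (1 / (p : ENNReal).toReal - 1 / ENNReal.toReal 2) = C₁ := by
    refine ⟨_, (ENNReal.coe_toNNReal (ENNReal.rpow_ne_top_of_nonneg ?_ ?_)).symm⟩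
    · rw [ENNReal.coe_toReal, hp]; norm_num
    · rwa [Measure.restrict_apply_univ]
  refine ⟨C₀ * C₁, fun ψ hψ => ?_⟩
  have hcont : Continuous (fderiv ℝ ψ) := hψ.smooth.continuous_fderiv (by simp)
  have h1 : eLpNorm (fderiv ℝ ψ) p volume = eLpNorm (fderiv ℝ ψ) p (dom Ω) := by
    have hsupp : Function.support (fun x => ‖fderiv ℝ ψ x‖) ⊆ Ω := fun x hx =>
      hψ.support (support_fderiv_subset ℝ fun h0 => hx (norm_eq_zero.2 h0))
    rw [← eLpNorm_norm (fderiv ℝ ψ), ← eLpNorm_norm (fderiv ℝ ψ)]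
    exact (eLpNorm_restrict_eq_of_support_subset hsupp).symm
  have h2 := eLpNorm_le_eLpNorm_mul_rpow_measure_univ (μ := dom Ω) hp2
    hcont.aestronglyMeasurable
  rw [hC₁] at h2
  have h3 : eLpNorm (fderiv ℝ ψ) 2 (dom Ω) ≤ eLpNorm (jacobian ψ) 2 (dom Ω) :=
    eLpNorm_mono fun x => norm_fderiv_le_norm_jacobian ψ x
  calc eLpNorm ψ 2 (dom Ω) ≤ eLpNorm ψ 2 volume := eLpNorm_mono_measure _ Measure.restrict_le_self
    _ ≤ C₀ * eLpNorm (fderiv ℝ ψ) p (dom Ω) := by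
      rw [← h1]; exact hC₀ ψ hψ
    _ ≤ C₀ * (eLpNorm (jacobian ψ) 2 (dom Ω) * C₁) := by
      gcongr
      exact h2.trans (by gcongr)
    _ = _ := by rw [ENNReal.coe_mul]; ring

theorem jacobian_add {ψ χ : Vec d → Vec d} (hψ : Differentiable ℝ ψ) (hχ : Differentiable ℝ χ) :
    jacobian (ψ + χ) = jacobian ψ + jacobian χ := by
  ext x p
  simp [jacobian, fderiv_add (hψ x) (hχ x)]

theorem jacobian_const_smul {ψ : Vec d → Vec d} (hψ : Differentiable ℝ ψ) (c : ℝ) :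
    jacobian (c • ψ) = c • jacobian ψ := by
  ext x p
  simp [jacobian, fderiv_const_smul (hψ x) c]

theorem IsTestField.add {ψ χ : Vec d → Vec d} (hψ : IsTestField Ω ψ) (hχ : IsTestField Ω χ) :
    IsTestField Ω (ψ + χ) where
  smooth := hψ.smooth.add hχ.smooth
  compact := hψ.compact.add hχ.compact
  support := (tsupport_add ψ χ).trans (Set.union_subset hψ.support hχ.support)

theorem IsTestField.const_smul {ψ : Vec d → Vec d} (hψ : IsTestField Ω ψ) (c : ℝ) :
    IsTestField Ω (c • ψ) where
  smooth := hψ.smooth.const_smul c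
  compact := hψ.compact.smul_left (f := fun _ => c)
  support := (tsupport_smul_subset_right (fun _ => c) ψ).trans hψ.support

theorem IsTestField.zero : IsTestField Ω (0 : Vec d → Vec d) where
  smooth := contDiff_const
  compact := HasCompactSupport.zero
  support := by simp [tsupport]

/-- The Poincaré inequality on `H¹₀`. -/
theorem exists_norm_vel_le (hd : d = 2 ∨ d = 3) (hΩb : Bornology.IsBounded Ω) :
    ∃ C : ℝ, 0 ≤ C ∧ ∀ u : H10 Ω, ‖vel u‖ ≤ C * ‖grad u‖ := by
  obtain ⟨C, hC⟩ := eLpNorm_testField_le hd hΩb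
  refine ⟨C, C.2, fun u => ?_⟩
  have hclosed : IsClosed {U : WithLp 2 (L2 Ω × L2Mat Ω) | ‖U.fst‖ ≤ C * ‖U.snd‖} :=
    isClosed_le (WithLp.fstL 2 ℝ (L2 Ω) (L2Mat Ω)).continuous.norm
      (continuous_const.mul (WithLp.sndL 2 ℝ (L2 Ω) (L2Mat Ω)).continuous.norm)
  refine closure_minimal (fun U hU => ?_) hclosed u.2
  -- The generating set is already a linear subspace, so taking the span adds nothing; the closed
  -- inequality then passes to the closure.
  have hrep : ∃ ψ : Vec d → Vec d, IsTestField Ω ψ ∧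
      U.fst =ᵐ[dom Ω] ψ ∧ U.snd =ᵐ[dom Ω] jacobian ψ := by
    have hdiff : ∀ {ψ : Vec d → Vec d}, IsTestField Ω ψ → Differentiable ℝ ψ := fun h =>
      h.smooth.differentiable (by simp)
    refine Submodule.span_induction (fun _ h => h) ?_ ?_ ?_ hU
    · refine ⟨0, .zero, Lp.coeFn_zero _ _ _, (Lp.coeFn_zero _ _ _).trans ?_⟩
      refine Filter.Eventually.of_forall fun x => ?_
      ext p
      simp [jacobian]
    · rintro U W _ _ ⟨ψ, hψ, h1, h2⟩ ⟨χ, hχ, h3, h4⟩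
      refine ⟨ψ + χ, hψ.add hχ, (Lp.coeFn_add _ _).trans (h1.add h3), ?_⟩
      rw [jacobian_add (hdiff hψ) (hdiff hχ)]
      exact (Lp.coeFn_add _ _).trans (h2.add h4)
    · rintro c U _ ⟨ψ, hψ, h1, h2⟩
      refine ⟨c • ψ, hψ.const_smul c, (Lp.coeFn_smul _ _).trans (h1.const_smul c), ?_⟩
      rw [jacobian_const_smul (hdiff hψ)]
      exact (Lp.coeFn_smul _ _).trans (h2.const_smul c)
  obtain ⟨ψ, hψ, h1, h2⟩ := hrep
  have h3 := hC ψ hψ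
  rw [← eLpNorm_congr_ae h1, ← eLpNorm_congr_ae h2] at h3
  have h4 := ENNReal.toReal_mono (ENNReal.mul_ne_top ENNReal.coe_ne_top (Lp.eLpNorm_ne_top _)) h3
  rwa [ENNReal.toReal_mul, ENNReal.coe_toReal] at h4

variable (Ω) in
/-- `vel` as a continuous linear map. -/
noncomputable def velL : H10 Ω →L[ℝ] L2 Ω :=
  (WithLp.fstL 2 ℝ (L2 Ω) (L2Mat Ω)).comp (H10 Ω).subtypeL

variable (Ω) in
/-- `grad` as a continuous linear map. -/
noncomputable def gradL : H10 Ω →L[ℝ] L2Mat Ω :=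
  (WithLp.sndL 2 ℝ (L2 Ω) (L2Mat Ω)).comp (H10 Ω).subtypeL

theorem norm_sq_H10 (u : H10 Ω) : ‖u‖ ^ 2 = ‖vel u‖ ^ 2 + ‖grad u‖ ^ 2 :=
  WithLp.prod_norm_sq_eq_of_L2 (u : WithLp 2 (L2 Ω × L2Mat Ω))

theorem exists_mul_norm_le_norm_grad (hd : d = 2 ∨ d = 3)
    (hΩb : Bornology.IsBounded Ω) : ∃ c : ℝ, 0 < c ∧ ∀ u : H10 Ω, c * ‖u‖ ≤ ‖grad u‖ := by
  obtain ⟨C, hC0, hC⟩ := exists_norm_vel_le hd hΩb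
  refine ⟨(C + 1)⁻¹, by positivity, fun u => ?_⟩
  rw [inv_mul_le_iff₀ (by positivity), ← sq_le_sq₀ (norm_nonneg _) (by positivity), norm_sq_H10]
  have h1 := pow_le_pow_left₀ (norm_nonneg _) (hC u) 2
  have h2 : 0 ≤ C * ‖grad u‖ ^ 2 := by positivity
  nlinarith

/-- By Poincaré the set in `dualNorm` is bounded above, so its `sSup` is a genuine supremum, and a
field with zero gradient is zero; otherwise rescale `v`. -/
theorem abs_apply_le_dualNorm_mul (hd : d = 2 ∨ d = 3)
    (hΩb : Bornology.IsBounded Ω) (f : StrongDual ℝ (H10 Ω)) (v : H10 Ω) :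
    |f v| ≤ dualNorm f * ‖grad v‖ := by
  obtain ⟨c, hc0, hc⟩ := exists_mul_norm_le_norm_grad hd hΩb
  have hnorm : ∀ v : H10 Ω, ‖v‖ ≤ c⁻¹ * ‖grad v‖ := fun v => by
    rw [← div_eq_inv_mul, le_div_iff₀ hc0, mul_comm]; exact hc v
  have hbdd : BddAbove {c : ℝ | ∃ v : H10 Ω, ‖grad v‖ ≤ 1 ∧ c = |f v|} := by
    refine ⟨‖f‖ * c⁻¹, ?_⟩
    rintro _ ⟨v, hv, rfl⟩
    refine (f.le_opNorm v).trans ?_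
    gcongr
    exact (hnorm v).trans (mul_le_of_le_one_right (by positivity) hv)
  rcases eq_or_ne ‖grad v‖ 0 with h0 | h0
  · have hv : v = 0 := by
      have := hnorm v
      rw [h0, mul_zero] at this
      exact norm_le_zero_iff.1 this
    rw [h0, hv, map_zero, abs_zero, mul_zero]
  · have hgs : grad (‖grad v‖⁻¹ • v) = ‖grad v‖⁻¹ • grad v := (gradL Ω).map_smul _ _
    have h1 : |f (‖grad v‖⁻¹ • v)| ≤ dualNorm f := le_csSup hbdd
      ⟨_, by rw [hgs, norm_smul, norm_inv, norm_norm, inv_mul_cancel₀ h0], rfl⟩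
    rwa [map_smul, smul_eq_mul, abs_mul, abs_of_nonneg (by positivity),
      inv_mul_le_iff₀ (lt_of_le_of_ne (norm_nonneg _) h0.symm), mul_comm] at h1

end Poincare

/-! ### Bilinearity and integrability of the convective derivative. -/

section Convection

variable {d : ℕ} {Ω : Set (Vec d)}

theorem conv_add_left (u u' v : H10 Ω) : conv (u + u') v =ᵐ[dom Ω] conv u v + conv u' v := by
  have h : vel (u + u') =ᵐ[dom Ω] vel u + vel u' := Lp.coeFn_add (vel u) (vel u')
  filter_upwards [h] with x hx
  ext j
  simp [conv, hx, add_mul, Finset.sum_add_distrib]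

theorem conv_smul_left (c : ℝ) (u v : H10 Ω) : conv (c • u) v =ᵐ[dom Ω] c • conv u v := by
  have h : vel (c • u) =ᵐ[dom Ω] c • vel u := Lp.coeFn_smul c (vel u)
  filter_upwards [h] with x hx
  ext j
  simp [conv, hx, mul_assoc, Finset.mul_sum]

theorem conv_add_right (u v v' : H10 Ω) : conv u (v + v') =ᵐ[dom Ω] conv u v + conv u v' := by
  have h : grad (v + v') =ᵐ[dom Ω] grad v + grad v' := Lp.coeFn_add (grad v) (grad v')
  filter_upwards [h] with x hx
  ext j
  simp [conv, hx, mul_add, Finset.sum_add_distrib]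

theorem conv_smul_right (c : ℝ) (u v : H10 Ω) : conv u (c • v) =ᵐ[dom Ω] c • conv u v := by
  have h : grad (c • v) =ᵐ[dom Ω] c • grad v := Lp.coeFn_smul c (grad v)
  filter_upwards [h] with x hx
  ext j
  simp [conv, hx, mul_left_comm, Finset.mul_sum]

/-- Square integrability is assumed for pairs of snapshots only; almost-everywhere bilinearity
carries it to their span, which contains the modes. There `convL2` never takes its default value
`0`. -/
theorem conv_memLp_of_mem_span {Y : Set (H10 Ω)}
    (hY : ∀ u ∈ Y, ∀ v ∈ Y, MemLp (conv u v) 2 (dom Ω)) {u v : H10 Ω}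
    (hu : u ∈ Submodule.span ℝ Y) (hv : v ∈ Submodule.span ℝ Y) :
    MemLp (conv u v) 2 (dom Ω) := by
  have hsmulL : ∀ (c : ℝ) (u v : H10 Ω), MemLp (conv u v) 2 (dom Ω) →
      MemLp (conv (c • u) v) 2 (dom Ω) := fun c u v h =>
    (memLp_congr_ae (conv_smul_left c u v)).2 (h.const_smul c)
  have hsmulR : ∀ (c : ℝ) (u v : H10 Ω), MemLp (conv u v) 2 (dom Ω) →
      MemLp (conv u (c • v)) 2 (dom Ω) := fun c u v h =>
    (memLp_congr_ae (conv_smul_right c u v)).2 (h.const_smul c)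
  have hzeroL : ∀ v : H10 Ω, MemLp (conv 0 v) 2 (dom Ω) := fun v => by
    have h := conv_smul_left (0 : ℝ) 0 v
    rw [zero_smul, zero_smul] at h
    exact (memLp_congr_ae h).2 MemLp.zero
  have hzeroR : ∀ u : H10 Ω, MemLp (conv u 0) 2 (dom Ω) := fun u => by
    have h := conv_smul_right (0 : ℝ) u 0
    rw [zero_smul, zero_smul] at h
    exact (memLp_congr_ae h).2 MemLp.zero
  refine Submodule.span_induction₂ (p := fun u v _ _ => MemLp (conv u v) 2 (dom Ω))
    (fun u v hu hv => hY u hu v hv) (fun v _ => hzeroL v) (fun u _ => hzeroR u)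
    (fun u u' v _ _ _ h h' => (memLp_congr_ae (conv_add_left u u' v)).2 (h.add h'))
    (fun u v v' _ _ _ h h' => (memLp_congr_ae (conv_add_right u v v')).2 (h.add h'))
    (fun c u v _ _ h => hsmulL c u v h) (fun c u v _ _ h => hsmulR c u v h) hu hv

theorem convL2_coeFn {u v : H10 Ω} (h : MemLp (conv u v) 2 (dom Ω)) :
    convL2 u v =ᵐ[dom Ω] conv u v := by
  rw [convL2, dif_pos h]
  exact h.coeFn_toLp

/-- The convective derivative as a bilinear map into `L²` on a space of fields on which it takes
values there. -/
noncomputable def convBilin (V : Submodule ℝ (H10 Ω))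
    (hV : ∀ u ∈ V, ∀ v ∈ V, MemLp (conv u v) 2 (dom Ω)) : V →ₗ[ℝ] V →ₗ[ℝ] L2 Ω :=
  LinearMap.mk₂ ℝ (fun u v => convL2 (u : H10 Ω) (v : H10 Ω))
    (fun u u' v => Lp.ext <| by
      refine (convL2_coeFn (hV _ (u + u').2 _ v.2)).trans ?_
      refine (conv_add_left (u : H10 Ω) u' v).trans ?_
      refine .trans ?_ (Lp.coeFn_add _ _).symm
      exact ((convL2_coeFn (hV _ u.2 _ v.2)).add (convL2_coeFn (hV _ u'.2 _ v.2))).symm)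
    (fun c u v => Lp.ext <| by
      refine (convL2_coeFn (hV _ (c • u).2 _ v.2)).trans ?_
      refine (conv_smul_left c (u : H10 Ω) v).trans ?_
      refine .trans ?_ (Lp.coeFn_smul _ _).symm
      exact ((convL2_coeFn (hV _ u.2 _ v.2)).const_smul c).symm)
    (fun u v v' => Lp.ext <| by
      refine (convL2_coeFn (hV _ u.2 _ (v + v').2)).trans ?_
      refine (conv_add_right (u : H10 Ω) v v').trans ?_
      refine .trans ?_ (Lp.coeFn_add _ _).symm
      exact ((convL2_coeFn (hV _ u.2 _ v.2)).add (convL2_coeFn (hV _ u.2 _ v'.2))).symm)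
    (fun c u v => Lp.ext <| by
      refine (convL2_coeFn (hV _ u.2 _ (c • v).2)).trans ?_
      refine (conv_smul_right c (u : H10 Ω) v).trans ?_
      refine .trans ?_ (Lp.coeFn_smul _ _).symm
      exact ((convL2_coeFn (hV _ u.2 _ v.2)).const_smul c).symm)

theorem integral_inner_conv_vel {u v : H10 Ω} (h : MemLp (conv u v) 2 (dom Ω)) (w : H10 Ω) :
    ∫ x, inner ℝ (conv u v x) (vel w x) ∂(dom Ω) = inner ℝ (convL2 u v) (vel w) := by
  rw [L2.inner_def]
  refine integral_congr_ae ?_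
  filter_upwards [convL2_coeFn h] with x hx
  rw [hx]

end Convection

/-! ### The stabilizing form on `L²`. -/

section Stabilization

variable {d : ℕ} {Ω : Set (Vec d)}

/-- With restrictions to cells as bounded operators, positivity and continuity of the form are
inherited from `L²` inner products. -/
theorem tauInner_eq_sum (cells : Finset (Set (Vec d))) (τ : Set (Vec d) → ℝ) (g h : L2 Ω) :
    tauInner cells τ g h = ∑ K ∈ cells, τ K *
      inner ℝ (LpToLpRestrictCLM (Vec d) (Vec d) ℝ (dom Ω) 2 K g)
        (LpToLpRestrictCLM (Vec d) (Vec d) ℝ (dom Ω) 2 K h) := by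
  refine Finset.sum_congr rfl fun K _ => ?_
  rw [L2.inner_def]
  congr 1
  refine integral_congr_ae ?_
  filter_upwards [LpToLpRestrictCLM_coeFn ℝ K g, LpToLpRestrictCLM_coeFn ℝ K h] with x hg hh
  rw [hg, hh]

theorem tauInner_self_nonneg {cells : Finset (Set (Vec d))} {τ : Set (Vec d) → ℝ}
    (hτ : ∀ K ∈ cells, 0 < τ K) (g : L2 Ω) : 0 ≤ tauInner cells τ g g := by
  rw [tauInner_eq_sum]
  exact Finset.sum_nonneg fun K hK => mul_nonneg (hτ K hK).le real_inner_self_nonneg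

/-- The form `(P' g, P' h)_τ` as a continuous bilinear form on `L²`. -/
noncomputable def stabForm (cells : Finset (Set (Vec d))) (τ : Set (Vec d) → ℝ)
    (P : L2 Ω →L[ℝ] L2 Ω) : L2 Ω →L[ℝ] L2 Ω →L[ℝ] ℝ :=
  ∑ K ∈ cells, τ K • (innerSL ℝ).bilinearComp
    ((LpToLpRestrictCLM (Vec d) (Vec d) ℝ (dom Ω) 2 K).comp P)
    ((LpToLpRestrictCLM (Vec d) (Vec d) ℝ (dom Ω) 2 K).comp P)

theorem stabForm_apply (cells : Finset (Set (Vec d))) (τ : Set (Vec d) → ℝ)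
    (P : L2 Ω →L[ℝ] L2 Ω) (g h : L2 Ω) :
    stabForm cells τ P g h = tauInner cells τ (P g) (P h) := by
  simp [stabForm, tauInner_eq_sum]

end Stabilization

/-! ### Solvability and energy balance of one step. -/

section Steps

variable {d : ℕ} {Ω : Set (Vec d)} {cells : Finset (Set (Vec d))} {τ : Set (Vec d) → ℝ} {r R : ℕ}
  {φ : Fin r → H10 Ω} {φhat : Fin R → L2 Ω} {ν Δt : ℝ}

theorem IsPODBasis.mem_span {H : Type*} [AddCommGroup H] [Module ℝ H] {ip : H → H → ℝ} {S r : ℕ}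
    {Y : Fin S → H} {φ : Fin r → H} (h : IsPODBasis ip Y φ) (i : Fin r) :
    φ i ∈ Submodule.span ℝ (Set.range Y) := by
  obtain ⟨z, lam, hr, -, -, hφ⟩ := h
  rw [(hφ i).2]
  exact Submodule.smul_mem _ _ (Submodule.sum_mem _ fun n _ =>
    Submodule.smul_mem _ _ (Submodule.subset_span ⟨n, rfl⟩))

theorem exists_isStep (hd : d = 2 ∨ d = 3) (hΩb : Bornology.IsBounded Ω)
    (hτ : ∀ K ∈ cells, 0 < τ K) (hν : 0 < ν) (hΔt : 0 < Δt)
    (hconv : ∀ u ∈ Submodule.span ℝ (Set.range φ), ∀ v ∈ Submodule.span ℝ (Set.range φ),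
      MemLp (conv u v) 2 (dom Ω))
    (f : StrongDual ℝ (H10 Ω)) (v : H10 Ω) : ∃ w, IsStep cells τ φ φhat ν Δt f v w := by
  obtain ⟨c, hc0, hc⟩ := exists_mul_norm_le_norm_grad hd hΩb
  set V := Submodule.span ℝ (Set.range φ)
  have hfin : FiniteDimensional ℝ V := FiniteDimensional.span_of_finite ℝ (Set.finite_range φ)
  let P : L2 Ω →L[ℝ] L2 Ω := ContinuousLinearMap.id ℝ (L2 Ω) -
    (Submodule.span ℝ (Set.range φhat)).starProjection
  let p : V →L[ℝ] L2 Ω := (velL Ω).comp V.subtypeL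
  let D : V →L[ℝ] L2Mat Ω := (gradL Ω).comp V.subtypeL
  -- Continuity is automatic because `V` is finite-dimensional.
  let C : V →L[ℝ] V →L[ℝ] L2 Ω := (convBilin V hconv).toContinuousBilinearMap
  let B : L2 Ω →L[ℝ] L2 Ω →L[ℝ] ℝ := stabForm cells τ P
  let f' : V →L[ℝ] ℝ := f.comp V.subtypeL
  have hB : ∀ g, 0 ≤ B g g := fun g => by
    rw [stabForm_apply]
    exact tauInner_self_nonneg hτ _
  have hD : ∀ x : V, c * ‖x‖ ≤ ‖D x‖ := fun x => hc x
  have hgal := @exists_galerkin_step V (L2 Ω) (L2Mat Ω) _ _ hfin _ _ _ _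
  obtain ⟨w, hw⟩ := hgal p D C B hB f' (vel v) (inv_nonneg.2 hΔt.le) hν hc0 hD
  refine ⟨w, w.2, fun ψ hψ => ?_⟩
  have h := hw ⟨ψ, hψ⟩
  rw [stabForm_apply] at h
  rw [trilinear, integral_inner_conv_vel (hconv _ w.2 _ w.2),
    integral_inner_conv_vel (hconv _ w.2 _ hψ)]
  exact h

/-- The energy balance of one step. -/
theorem IsStep.energy (hd : d = 2 ∨ d = 3) (hΩb : Bornology.IsBounded Ω)
    (hτ : ∀ K ∈ cells, 0 < τ K) (hν : 0 < ν) (hΔt : 0 < Δt)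
    {f : StrongDual ℝ (H10 Ω)} {v w : H10 Ω} (h : IsStep cells τ φ φhat ν Δt f v w) :
    ‖vel w‖ ^ 2 + Δt * (ν * ‖grad w‖ ^ 2 + tauNorm cells τ (highConv φhat w w) ^ 2) ≤
      ‖vel v‖ ^ 2 + Δt / ν * dualNorm f ^ 2 := by
  have h1 := h.2 w h.1
  have hs : 0 ≤ tauInner cells τ (highConv φhat w w) (highConv φhat w w) :=
    tauInner_self_nonneg hτ _
  rw [tauNorm, Real.sq_sqrt hs]
  set s := tauInner cells τ (highConv φhat w w) (highConv φhat w w)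
  -- On the diagonal the two convective integrals are the same expression, so they cancel without
  -- any integrability.
  rw [trilinear, sub_self, mul_zero, add_zero, gradInner, real_inner_self_eq_norm_sq,
    real_inner_smul_left, inner_sub_left, real_inner_self_eq_norm_sq] at h1
  have h2 : inner ℝ (vel v) (vel w) ≤ (‖vel v‖ ^ 2 + ‖vel w‖ ^ 2) / 2 := by
    have := real_inner_le_norm (vel v) (vel w)
    nlinarith [sq_nonneg (‖vel v‖ - ‖vel w‖)]
  have h3 : f w ≤ (dualNorm f ^ 2 / ν + ν * ‖grad w‖ ^ 2) / 2 := by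
    have h4 := (le_abs_self _).trans (abs_apply_le_dualNorm_mul hd hΩb f w)
    -- Young's inequality, weighted so that half of the viscous term remains.
    have h5 : dualNorm f ^ 2 / ν + ν * ‖grad w‖ ^ 2 - 2 * (dualNorm f * ‖grad w‖) =
        (dualNorm f - ν * ‖grad w‖) ^ 2 / ν := by
      field_simp
      ring
    have h6 : 0 ≤ (dualNorm f - ν * ‖grad w‖) ^ 2 / ν := by positivity
    linarith
  have h7 : ‖vel w‖ ^ 2 - inner ℝ (vel v) (vel w) + Δt * (ν * ‖grad w‖ ^ 2 + s) = Δt * f w := by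
    rw [← h1]
    field_simp
    ring
  have h8 : Δt * f w ≤ Δt * ((dualNorm f ^ 2 / ν + ν * ‖grad w‖ ^ 2) / 2) := by gcongr
  have h9 : Δt / ν * dualNorm f ^ 2 = Δt * (dualNorm f ^ 2 / ν) := by ring
  have h10 : 0 ≤ Δt * s := by positivity
  rw [h9]
  linarith

end Steps

end SDPODROM

/-! ### Assembly over the time steps. -/

theorem mainTheorem3
    {d : ℕ} (hd : d = 2 ∨ d = 3)
    -- the domain, its mesh, and the stabilization parameters
    (Ω : Set (SDPODROM.Vec d)) (hΩ : IsOpen Ω) (hΩb : Bornology.IsBounded Ω)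
    (cells : Finset (Set (SDPODROM.Vec d))) (hcells : SDPODROM.IsTriangulation Ω cells)
    (τ : Set (SDPODROM.Vec d) → ℝ) (hτ : ∀ K ∈ cells, 0 < τ K)
    -- viscosity, final time, number of time steps, force, initial velocity
    (ν : ℝ) (hν : 0 < ν) (T : ℝ) (hT : 0 < T) (N : ℕ) (hN : 0 < N)
    (f : ℝ → StrongDual ℝ (SDPODROM.H10 Ω)) (u0 : SDPODROM.H10 Ω)
    -- velocity snapshots and their POD modes in the gradient inner product
    {S r : ℕ} (Y : Fin S → SDPODROM.H10 Ω)
    (hY : ∀ i j, MemLp (SDPODROM.conv (Y i) (Y j)) 2 (SDPODROM.dom Ω))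
    (φ : Fin r → SDPODROM.H10 Ω) (hφ : SDPODROM.IsPODBasis SDPODROM.gradInner Y φ)
    -- the POD modes in `L²` of the convective derivatives of the computed velocities
    (uh : Fin N → SDPODROM.H10 Ω)
    (huh : ∀ n, MemLp (SDPODROM.conv (uh n) (uh n)) 2 (SDPODROM.dom Ω))
    {R : ℕ} (hR : R ≤ r) (φhat : Fin R → SDPODROM.L2 Ω)
    (hφhat : SDPODROM.IsPODBasis (fun g h : SDPODROM.L2 Ω => inner ℝ g h)
      (fun n => SDPODROM.convL2 (uh n) (uh n)) φhat) :
    -- every time step is solvable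
    (∀ n < N, ∀ v ∈ Submodule.span ℝ (Set.range φ), ∃ w,
      SDPODROM.IsStep cells τ φ φhat ν (T / N) (f (((n : ℝ) + 1) * (T / N))) v w) ∧
    -- the discrete problem has a solution
    (∃ u, SDPODROM.IsSolution cells τ φ φhat ν (T / N) N f u0 u) ∧
    -- stability
    (∀ u, SDPODROM.IsSolution cells τ φ φhat ν (T / N) N f u0 u →
      ∀ k ≤ N,
        ‖SDPODROM.vel (u k)‖ ^ 2 + (T / N) * ∑ n ∈ Finset.range k,
            (ν * ‖SDPODROM.grad (u (n + 1))‖ ^ 2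
              + SDPODROM.tauNorm cells τ
                  (SDPODROM.highConv φhat (u (n + 1)) (u (n + 1))) ^ 2)
          ≤ ‖SDPODROM.vel (u 0)‖ ^ 2 + (T / N) / ν * ∑ n ∈ Finset.range k,
              SDPODROM.dualNorm (f (((n : ℝ) + 1) * (T / N))) ^ 2) := by
  have hN' : (0 : ℝ) < N := by exact_mod_cast hN
  have hΔt : 0 < T / N := div_pos hT hN'
  have hspan : Submodule.span ℝ (Set.range φ) ≤ Submodule.span ℝ (Set.range Y) :=
    Submodule.span_le.2 (by rintro _ ⟨i, rfl⟩; exact hφ.mem_span i)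
  have hconv : ∀ u ∈ Submodule.span ℝ (Set.range φ), ∀ v ∈ Submodule.span ℝ (Set.range φ),
      MemLp (SDPODROM.conv u v) 2 (SDPODROM.dom Ω) := fun u hu v hv =>
    SDPODROM.conv_memLp_of_mem_span
      (by rintro _ ⟨i, rfl⟩ _ ⟨j, rfl⟩; exact hY i j) (hspan hu) (hspan hv)
  have hstep : ∀ (g : StrongDual ℝ (SDPODROM.H10 Ω)) (v : SDPODROM.H10 Ω),
      ∃ w, SDPODROM.IsStep cells τ φ φhat ν (T / N) g v w :=
    fun g v => SDPODROM.exists_isStep hd hΩb hτ hν hΔt hconv g v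
  refine ⟨fun n _ v _ => hstep _ v, ?_, fun u hu k hk => ?_⟩
  -- Steps are solvable from any old velocity, so the recursion need not track membership in the
  -- span.
  · choose next hnext using hstep
    exact ⟨fun n => Nat.rec (SDPODROM.initialValue φ u0)
      (fun n v => next (f (((n : ℝ) + 1) * (T / N))) v) n, rfl, fun n _ => hnext _ _⟩
  · induction k with
    | zero => simp
    | succ k ih =>
      have h1 := ih (Nat.le_of_succ_le hk)
      have h2 := (hu.2 k hk).energy hd hΩb hτ hν hΔt
      rw [Finset.sum_range_succ, Finset.sum_range_succ, mul_add, mul_add]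
      linarith
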